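/- For an integer $b \ge 2$ let $$\mathfrak{D}_b := \Big\{\sum_{d=0}^{\infty} a_d b^d : a_d \in \{0,1\},\ 0 < \sum_{d=0}^{\infty} a_d < \infty\Big\}$$ be the set of positive integers whose base-$b$ digits are all $0$ or $1$, and let $\|x\|$ denote the distance from the real number $x$ to the nearest integer. For every integer $b\ge 2$ there is an effective constant $C_b$, depending only on $b$, such that for every $\gamma \in \mathbb{R}$ and every integer $N \ge 2$, $$\min_{1 \le n \le N,\ n \in \mathfrak{D}_b} \|\gamma n\| \le \frac{C_b}{(\log N)^2}.$$ Here "effective" means that the constants can be chosen so that $b \mapsto C_b$ is a computable function with values in the non-negative integers. -/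

import Mathlib

/-- The positive integers that are sums `∑ a_d b^d` with finitely many, but at least one, of the
digits `a_d ∈ {0, 1}` nonzero; `s` is the set of positions `d` with `a_d = 1`. -/
def zeroOneDigitSet (b : ℕ) : Set ℕ :=
  {n | ∃ s : Finset ℕ, s.Nonempty ∧ n = ∑ d ∈ s, b ^ d}

/-- The distance `‖x‖` from a real number to the nearest integer. -/
noncomputable def distNearestInt (x : ℝ) : ℝ := |x - round x|

open Finset

/-! ### Distance to the nearest integer -/

/-! With `K = Nat.log b N`, it suffices to find a small subset sum of `γ b^d`, `d < K`; a bound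
`2^(-u)` with `u` of order `K^(1/3)` is reached, more than enough. By a second-moment argument
(`exists_subset_sum_distNearestInt_le`), failure forces a large product `∏ (1 + e(kγb^d))/2` with `0
< |k| < 4^u`. Then few `d` have `‖kγb^d‖ ≥ 1/(2b)`, so some long window has none. There
multiplication by `b` scales the distance exactly, so `γb^d` at the window's start is extremely
close to a rational, and a further shift makes its denominator `q` coprime to `b`
(`near_rational_of_small_multiple`). For such a rational the obstruction cannot occur
(`exists_subset_sum_rational`), and its small subset sum transfers to `γ`. -/

theorem distNearestInt_nonneg (x : ℝ) : 0 ≤ distNearestInt x := abs_nonneg _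

theorem distNearestInt_le_half (x : ℝ) : distNearestInt x ≤ 1 / 2 := abs_sub_round x

theorem distNearestInt_le_abs_sub (x : ℝ) (m : ℤ) : distNearestInt x ≤ |x - m| := round_le x m

theorem distNearestInt_le_add_abs_sub (x y : ℝ) :
    distNearestInt x ≤ distNearestInt y + |x - y| := by
  refine (distNearestInt_le_abs_sub x (round y)).trans ?_
  have : x - round y = (y - round y) + (x - y) := by ring
  rw [this]
  exact abs_add_le _ _

theorem distNearestInt_neg (x : ℝ) : distNearestInt (-x) = distNearestInt x := by
  have h : ∀ y : ℝ, distNearestInt (-y) ≤ distNearestInt y := fun y ↦ by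
    refine (distNearestInt_le_abs_sub (-y) (-round y)).trans_eq ?_
    rw [distNearestInt, ← abs_neg]
    congr 1
    push_cast
    ring
  exact le_antisymm (h x) (by simpa using h (-x))

theorem distNearestInt_nat_mul {b : ℕ} (hb : 0 < b) {x : ℝ}
    (hx : distNearestInt x < 1 / (2 * b)) : distNearestInt (b * x) = b * distNearestInt x := by
  have hb' : (0 : ℝ) < b := by exact_mod_cast hb
  have h1 : |(b : ℝ) * (x - round x)| < 1 / 2 := by
    rw [abs_mul, abs_of_pos hb']
    unfold distNearestInt at hx
    rw [lt_div_iff₀ (by positivity)] at hx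
    linarith
  have h2 : round ((b : ℝ) * x) = b * round x := by
    rw [abs_lt] at h1
    rw [round_eq_iff]
    push_cast
    constructor <;> linarith [h1.1, h1.2]
  unfold distNearestInt
  rw [h2]
  push_cast
  rw [← mul_sub, abs_mul, abs_of_pos hb']

theorem distNearestInt_pow_mul_le {b : ℕ} (hb : 0 < b) (z : ℝ) (d L : ℕ)
    (h : ∀ i < L, distNearestInt (z * b ^ (d + i)) < 1 / (2 * b)) :
    distNearestInt (z * b ^ d) * b ^ L ≤ 1 / 2 := by
  have key : ∀ j ≤ L, distNearestInt (z * b ^ (d + j)) = distNearestInt (z * b ^ d) * b ^ j := by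
    intro j
    induction j with
    | zero => simp
    | succ j ih =>
      intro hj
      have := distNearestInt_nat_mul hb (h j hj)
      rw [ih (by omega)] at this
      rw [pow_succ, ← mul_assoc, mul_comm _ (b : ℝ), ← this]
      congr 1
      ring
  rw [← key L le_rfl]
  exact distNearestInt_le_half _

theorem one_div_le_distNearestInt_div {q : ℕ} (hq : 0 < q) {m : ℤ} (hm : ¬ (q : ℤ) ∣ m) :
    1 / (q : ℝ) ≤ distNearestInt (m / q) := by
  have hq' : (0 : ℝ) < q := by exact_mod_cast hq
  unfold distNearestInt
  set r := round ((m : ℝ) / q)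
  have h1 : (m : ℝ) / q - r = ((m - q * r : ℤ) : ℝ) / q := by
    push_cast
    field_simp
  rw [h1, abs_div, abs_of_pos hq']
  gcongr
  have h2 : m - q * r ≠ 0 := by
    intro h
    exact hm ⟨r, by linarith⟩
  exact_mod_cast Int.one_le_abs h2

/-! ### The additive character `x ↦ exp (2πix)` -/

/-- The additive character `x ↦ exp (2πix)` of `ℝ / ℤ`. -/
noncomputable def unitExp (x : ℝ) : ℂ := Complex.exp (Complex.I * ((2 * Real.pi * x : ℝ) : ℂ))

theorem unitExp_zero : unitExp 0 = 1 := by simp [unitExp]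

theorem unitExp_add (x y : ℝ) : unitExp (x + y) = unitExp x * unitExp y := by
  unfold unitExp
  rw [← Complex.exp_add]
  congr 1
  push_cast
  ring

theorem norm_unitExp (x : ℝ) : ‖unitExp x‖ = 1 := Complex.norm_exp_I_mul_ofReal _

theorem unitExp_intCast (m : ℤ) : unitExp m = 1 := by
  unfold unitExp
  rw [Complex.exp_eq_one_iff]
  exact ⟨m, by push_cast; ring⟩

theorem unitExp_neg (x : ℝ) : unitExp (-x) = starRingEnd ℂ (unitExp x) := by
  unfold unitExp
  rw [← Complex.exp_conj, map_mul, Complex.conj_I, Complex.conj_ofReal]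
  congr 1
  push_cast
  ring

theorem unitExp_nat_mul (n : ℕ) (x : ℝ) : unitExp (n * x) = unitExp x ^ n := by
  unfold unitExp
  rw [← Complex.exp_nat_mul]
  congr 1
  push_cast
  ring

theorem unitExp_sum (s : Finset ℕ) (x : ℕ → ℝ) :
    unitExp (∑ d ∈ s, x d) = ∏ d ∈ s, unitExp (x d) := by
  unfold unitExp
  rw [← Complex.exp_sum]
  congr 1
  push_cast
  simp only [mul_sum]

theorem two_mul_distNearestInt_le_abs_sin (x : ℝ) :
    2 * distNearestInt x ≤ |Real.sin (Real.pi * x)| := by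
  have h : |Real.sin (Real.pi * x)| = |Real.sin (Real.pi * (x - round x))| := by
    rw [mul_sub, mul_comm Real.pi (round x : ℝ), Real.sin_sub_int_mul_pi, abs_mul, abs_zpow]
    simp
  rw [h]
  have h1 := abs_sub_round x
  unfold distNearestInt
  set y := x - round x
  have hpi := Real.pi_pos
  have h2 : |Real.sin (Real.pi * y)| = Real.sin (Real.pi * |y|) := by
    have := Real.abs_sin_eq_sin_abs_of_abs_le_pi (x := Real.pi * y) (by
      rw [abs_mul, abs_of_pos hpi]; nlinarith)
    rw [this, abs_mul, abs_of_pos hpi]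
  rw [h2]
  have := Real.mul_le_sin (x := Real.pi * |y|) (by positivity) (by nlinarith)
  calc 2 * |y| = 2 / Real.pi * (Real.pi * |y|) := by field_simp
    _ ≤ _ := this

theorem norm_unitExp_sub_one (x : ℝ) : ‖unitExp x - 1‖ = 2 * |Real.sin (Real.pi * x)| := by
  unfold unitExp
  rw [Complex.norm_exp_I_mul_ofReal_sub_one, Real.norm_eq_abs, abs_mul, abs_two]
  congr 3
  ring

theorem norm_one_add_unitExp_half_sq_le (x : ℝ) :
    ‖(1 + unitExp x) / 2‖ ^ 2 ≤ 1 - 4 * distNearestInt x ^ 2 := by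
  have h1 := parallelogram_law_with_norm ℝ (unitExp x) 1
  rw [norm_unitExp, norm_one, norm_unitExp_sub_one] at h1
  have h2 := two_mul_distNearestInt_le_abs_sin x
  have h3 := distNearestInt_nonneg x
  rw [norm_div, add_comm, div_pow]
  have : ‖(2 : ℂ)‖ = 2 := by simp
  rw [this]
  nlinarith

theorem norm_one_add_unitExp_half_le_one (x : ℝ) : ‖(1 + unitExp x) / 2‖ ≤ 1 := by
  have := norm_one_add_unitExp_half_sq_le x
  nlinarith [sq_nonneg (distNearestInt x), norm_nonneg ((1 + unitExp x) / 2)]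

theorem norm_sum_unitExp_le (n : ℕ) {x : ℝ} (hx : 0 < distNearestInt x) :
    ‖∑ h ∈ range n, unitExp (h * x)‖ ≤ 1 / (2 * distNearestInt x) := by
  simp only [unitExp_nat_mul]
  have h1 := congrArg norm (geom_sum_mul (unitExp x) n)
  rw [norm_mul, norm_unitExp_sub_one] at h1
  have h2 : ‖unitExp x ^ n - 1‖ ≤ 2 := by
    refine (norm_sub_le _ _).trans ?_
    rw [norm_pow, norm_unitExp]
    norm_num
  have h3 := two_mul_distNearestInt_le_abs_sin x
  rw [le_div_iff₀ (by positivity)]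
  have := norm_nonneg (∑ i ∈ range n, unitExp x ^ i)
  nlinarith

/-! ### Small subset sums from small exponential products -/

/-- The mean of `exp (2πi k s)` over all subset sums `s` of `x 0, …, x (K - 1)`. -/
noncomputable def subsetSumMean (K : ℕ) (x : ℕ → ℝ) (k : ℤ) : ℂ :=
  ∏ d ∈ range K, (1 + unitExp (k * x d)) / 2

theorem subsetSumMean_zero (K : ℕ) (x : ℕ → ℝ) : subsetSumMean K x 0 = 1 := by
  simp [subsetSumMean, unitExp_zero]

theorem sum_powerset_unitExp (K : ℕ) (x : ℕ → ℝ) (k : ℤ) :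
    ∑ S ∈ (range K).powerset, unitExp (k * ∑ d ∈ S, x d) = 2 ^ K * subsetSumMean K x k := by
  simp only [mul_sum, unitExp_sum]
  rw [← prod_one_add, subsetSumMean, prod_div_distrib]
  simp only [prod_const, card_range]
  field_simp

theorem norm_sum_unitExp_sq (n : ℕ) (x : ℝ) :
    ((‖∑ h ∈ range n, unitExp (h * x)‖ ^ 2 : ℝ) : ℂ) =
      ∑ h ∈ range n, ∑ k ∈ range n, unitExp (((h : ℤ) - (k : ℤ) : ℤ) * x) := by
  rw [← Complex.normSq_eq_norm_sq, ← Complex.mul_conj, map_sum, sum_mul_sum]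
  refine sum_congr rfl fun h _ ↦ sum_congr rfl fun k _ ↦ ?_
  rw [← unitExp_neg, ← unitExp_add]
  congr 1
  push_cast
  ring

theorem sum_norm_sum_unitExp_sq_eq (K n : ℕ) (x : ℕ → ℝ) :
    ∑ S ∈ (range K).powerset, ‖∑ h ∈ range n, unitExp (h * ∑ d ∈ S, x d)‖ ^ 2 =
      2 ^ K * ∑ h ∈ range n, ∑ k ∈ range n, (subsetSumMean K x ((h : ℤ) - k)).re := by
  have h : ((∑ S ∈ (range K).powerset, ‖∑ h ∈ range n, unitExp (h * ∑ d ∈ S, x d)‖ ^ 2 : ℝ) : ℂ)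
      = ((2 : ℝ) ^ K : ℝ) * ∑ h ∈ range n, ∑ k ∈ range n, subsetSumMean K x ((h : ℤ) - k) := by
    rw [Complex.ofReal_sum]
    simp only [norm_sum_unitExp_sq]
    rw [sum_comm, mul_sum]
    refine sum_congr rfl fun h _ ↦ ?_
    rw [sum_comm, mul_sum]
    refine sum_congr rfl fun k _ ↦ ?_
    rw [sum_powerset_unitExp]
    push_cast
    rfl
  have := congrArg Complex.re h
  rw [Complex.ofReal_re, Complex.re_ofReal_mul] at this
  simpa only [Complex.re_sum] using this

/-- The diagonal gives `n`; fewer than `n^2` other terms lose at most `1/(4n)` each. -/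
theorem le_sum_re_subsetSumMean (K n : ℕ) (x : ℕ → ℝ)
    (hx : ∀ k : ℤ, k ≠ 0 → |k| < n → -(1 / (4 * n)) ≤ (subsetSumMean K x k).re) :
    3 / 4 * (n : ℝ) ≤ ∑ h ∈ range n, ∑ k ∈ range n, (subsetSumMean K x ((h : ℤ) - k)).re := by
  have h1 : ∀ h ∈ range n, 3 / 4 ≤ ∑ k ∈ range n, (subsetSumMean K x ((h : ℤ) - k)).re := by
    intro h hh
    have hn : (0 : ℝ) < n := by
      have := mem_range.1 hh
      exact_mod_cast (by omega : 0 < n)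
    have h2 : ∀ k ∈ range n, (if k = h then (1 : ℝ) else 0) - 1 / (4 * n) ≤
        (subsetSumMean K x ((h : ℤ) - k)).re := by
      intro k hk
      split_ifs with hkh
      · subst hkh
        rw [sub_self, subsetSumMean_zero, Complex.one_re]
        have : 0 < 1 / (4 * (n : ℝ)) := by positivity
        linarith
      · rw [zero_sub]
        rw [mem_range] at hh hk
        exact hx _ (by omega) (by rw [abs_lt]; omega)
    have h3 := sum_le_sum h2
    rw [sum_sub_distrib, sum_ite_eq' (range n) h, if_pos hh, sum_const, card_range,
      nsmul_eq_mul] at h3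
    have h4 : (n : ℝ) * (1 / (4 * n)) = 1 / 4 := by field_simp
    linarith
  have := sum_le_sum h1
  rw [sum_const, card_range, nsmul_eq_mul] at this
  linarith

/-- If no exponential mean of order below `4 ^ u` has a very negative real part, then some nonempty
subset sum is within `2 ^ (-u)` of an integer. -/
theorem exists_subset_sum_distNearestInt_le (K u : ℕ) (hK : 2 * u + 2 ≤ K) (x : ℕ → ℝ)
    (hx : ∀ k : ℤ, k ≠ 0 → |k| < (4 ^ u : ℕ) →
      -(1 / (4 * (4 ^ u : ℕ))) ≤ (subsetSumMean K x k).re) :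
    ∃ S ⊆ range K, S.Nonempty ∧ distNearestInt (∑ d ∈ S, x d) ≤ 1 / 2 ^ u := by
  by_contra! hcon
  have h1 := le_sum_re_subsetSumMean K (4 ^ u) x hx
  have h2 := sum_norm_sum_unitExp_sq_eq K (4 ^ u) x
  set n : ℕ := 4 ^ u with hn
  have hnpos : (0 : ℝ) < n := by rw [hn]; positivity
  have h3 : ∀ S ∈ (range K).powerset, ‖∑ h ∈ range n, unitExp (h * ∑ d ∈ S, x d)‖ ^ 2 ≤
      (if S = ∅ then (n : ℝ) ^ 2 else 0) + n / 4 := by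
    intro S hS
    split_ifs with h
    · have : ‖∑ h ∈ range n, unitExp (h * ∑ d ∈ S, x d)‖ ≤ n := by
        refine (norm_sum_le _ _).trans ?_
        simp [norm_unitExp]
      have := pow_le_pow_left₀ (norm_nonneg _) this 2
      linarith
    · have hd := hcon S (mem_powerset.1 hS) (nonempty_iff_ne_empty.2 h)
      have hu : (0 : ℝ) < 1 / 2 ^ u := by positivity
      have h4 := norm_sum_unitExp_le n (hu.trans hd)
      have h5 : 1 / (2 * distNearestInt (∑ d ∈ S, x d)) ≤ 2 ^ u / 2 := by
        calc 1 / (2 * distNearestInt (∑ d ∈ S, x d)) ≤ 1 / (2 * (1 / 2 ^ u)) := by gcongr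
          _ = 2 ^ u / 2 := by field_simp
      have h6 := pow_le_pow_left₀ (norm_nonneg _) (h4.trans h5) 2
      have h7 : ((2 : ℝ) ^ u / 2) ^ 2 = n / 4 := by
        rw [hn, div_pow, ← pow_mul, mul_comm u 2, pow_mul]
        norm_num
      linarith
  have h4 := sum_le_sum h3
  rw [h2, sum_add_distrib, sum_ite_eq' _ ∅, if_pos (empty_mem_powerset _), sum_const,
    card_powerset, card_range, nsmul_eq_mul] at h4
  -- The empty set's share `n^2 / 2^K` is at most `n/4`, so the mean square is at most `n/2`,
  -- against the lower bound `3n/4`.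
  have h5 : (4 : ℝ) * n ≤ 2 ^ K := by
    calc (4 : ℝ) * n = 2 ^ (2 * u + 2) := by
          rw [hn, pow_add, pow_mul]
          norm_num
          ring
      _ ≤ 2 ^ K := pow_le_pow_right₀ (by norm_num) hK
  push_cast at h4
  have h6 := mul_le_mul_of_nonneg_left h1 (by positivity : (0 : ℝ) ≤ 2 ^ K)
  nlinarith

/-! ### Decay of exponential products -/

/-- Each `d ∈ M` costs a factor `1 - 1/b^2` in the squared norm, and `b^2` such factors at least
halve it. -/
theorem norm_subsetSumMean_le {b : ℕ} (hb : 2 ≤ b) (K u : ℕ) (x : ℕ → ℝ) (k : ℤ)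
    (M : Finset ℕ) (hM : M ⊆ range K) (hcard : b ^ 2 * (4 * u + 4) ≤ M.card)
    (hlarge : ∀ d ∈ M, 1 / (2 * b) ≤ distNearestInt (k * x d)) :
    ‖subsetSumMean K x k‖ ≤ 1 / (4 * (4 ^ u : ℕ)) := by
  have hb' : (2 : ℝ) ≤ b := by exact_mod_cast hb
  have hb0 : 1 / (b : ℝ) ^ 2 ≤ 1 := by
    rw [div_le_one (by positivity)]
    nlinarith
  have h1 : ‖subsetSumMean K x k‖ ≤ ∏ d ∈ M, ‖(1 + unitExp (k * x d)) / 2‖ := by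
    rw [subsetSumMean, norm_prod]
    rw [← prod_sdiff hM]
    exact mul_le_of_le_one_left (prod_nonneg fun _ _ ↦ norm_nonneg _)
      (prod_le_one (fun _ _ ↦ norm_nonneg _) fun _ _ ↦ norm_one_add_unitExp_half_le_one _)
  have h2 : (∏ d ∈ M, ‖(1 + unitExp (k * x d)) / 2‖) ^ 2 ≤ (1 - 1 / (b : ℝ) ^ 2) ^ M.card := by
    rw [← prod_pow, ← prod_const]
    refine prod_le_prod (fun _ _ ↦ by positivity) fun d hd ↦
      (norm_one_add_unitExp_half_sq_le _).trans ?_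
    have := pow_le_pow_left₀ (by positivity) (hlarge d hd) 2
    have h3 : (1 / (2 * (b : ℝ))) ^ 2 = 1 / b ^ 2 / 4 := by
      field_simp
      norm_num
    linarith
  have h3 : (1 - 1 / (b : ℝ) ^ 2) ^ (b ^ 2) ≤ 1 / 2 := by
    have h4 := Real.one_sub_div_pow_le_exp_neg (n := b ^ 2) (t := 1)
      (by push_cast; nlinarith)
    push_cast at h4
    refine h4.trans ?_
    have := Real.exp_one_gt_d9
    rw [Real.exp_neg, inv_eq_one_div]
    gcongr
    linarith
  have h4 : (1 - 1 / (b : ℝ) ^ 2) ^ M.card ≤ (1 / 2) ^ (4 * u + 4) := by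
    calc (1 - 1 / (b : ℝ) ^ 2) ^ M.card ≤ (1 - 1 / (b : ℝ) ^ 2) ^ (b ^ 2 * (4 * u + 4)) :=
          pow_le_pow_of_le_one (by linarith) (by linarith [show 0 ≤ 1 / (b : ℝ) ^ 2 by positivity])
            hcard
      _ = ((1 - 1 / (b : ℝ) ^ 2) ^ (b ^ 2)) ^ (4 * u + 4) := pow_mul _ _ _
      _ ≤ _ := pow_le_pow_left₀ (pow_nonneg (by linarith) _) h3 _
  have h5 : ((1 : ℝ) / 2) ^ (4 * u + 4) = (1 / (4 * (4 ^ u : ℕ))) ^ 2 := by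
    have : (4 : ℝ) = 2 ^ 2 := by norm_num
    push_cast
    rw [← pow_succ', this, ← pow_mul, div_pow, one_pow, div_pow, one_pow, ← pow_mul]
    congr 2
    ring
  refine h1.trans (le_of_sq_le_sq ?_ (by positivity))
  linarith

theorem norm_subsetSumMean_le_of_windows {b : ℕ} (hb : 2 ≤ b) (K u L : ℕ) (x : ℕ → ℝ) (k : ℤ)
    (hK : b ^ 2 * (4 * u + 4) * L ≤ K)
    (hlarge : ∀ j < b ^ 2 * (4 * u + 4), ∃ i < L,
      1 / (2 * b) ≤ distNearestInt (k * x (j * L + i))) :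
    ‖subsetSumMean K x k‖ ≤ 1 / (4 * (4 ^ u : ℕ)) := by
  choose! f hfL hf using hlarge
  set R := b ^ 2 * (4 * u + 4)
  refine norm_subsetSumMean_le hb K u x k ((range R).image fun j ↦ j * L + f j) ?_ ?_ ?_
  · intro d hd
    simp only [mem_image, mem_range] at hd ⊢
    obtain ⟨j, hj, rfl⟩ := hd
    have := hfL j hj
    nlinarith
  · rw [card_image_of_injOn, card_range]
    intro i hi j hj hij
    rw [mem_coe, mem_range] at hi hj
    have h1 := hfL i hi
    have h2 := hfL j hj
    have h3 : ∀ j < R, (j * L + f j) / L = j := fun j hj ↦ by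
      have := hfL j hj
      rw [mul_comm, Nat.mul_add_div (by omega), Nat.div_eq_of_lt this, add_zero]
    rw [← h3 i hi, ← h3 j hj]
    exact congrArg (· / L) hij
  · intro d hd
    simp only [mem_image, mem_range] at hd
    obtain ⟨j, hj, rfl⟩ := hd
    exact hf j hj

/-! ### Subset sums of an orbit of multiplication by `b` -/

/-- Divide by the gcd with `b` until it is 1: each division at least halves `h` and uses one factor
`b`. -/
theorem exists_coprime_dvd_mul_pow {b : ℕ} (h : ℕ) (hh : 0 < h) :
    ∃ q e : ℕ, 0 < q ∧ q ≤ h ∧ q.Coprime b ∧ 2 ^ e ≤ h ∧ h ∣ q * b ^ e := by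
  induction h using Nat.strong_induction_on with
  | _ h ih =>
    by_cases hc : h.Coprime b
    · exact ⟨h, 0, hh, le_rfl, hc, by rw [pow_zero]; exact hh, by simp⟩
    · set g := h.gcd b
      have hg : 0 < g := Nat.gcd_pos_of_pos_left _ hh
      have hg2 : 2 ≤ g := by
        have : g ≠ 1 := hc
        omega
      obtain ⟨h', hh'⟩ : g ∣ h := Nat.gcd_dvd_left _ _
      have hpos : 0 < h' := Nat.pos_of_ne_zero (by rintro rfl; omega)
      have hlt : 2 * h' ≤ h := by
        rw [hh']
        exact Nat.mul_le_mul_right _ hg2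
      obtain ⟨q, e, hq, hqle, hqb, he, hdvd⟩ := ih h' (by omega) hpos
      refine ⟨q, e + 1, hq, by omega, hqb, by rw [pow_succ]; omega, ?_⟩
      rw [hh', pow_succ, ← mul_assoc, mul_comm]
      exact mul_dvd_mul hdvd (Nat.gcd_dvd_right _ _)

/-- A geometric progression modulo `q` with ratio coprime to `q` has a small subset sum using
only about `(log q) ^ 2` terms. -/
theorem exists_subset_sum_rational {b : ℕ} (hb : 2 ≤ b) (u q : ℕ) (hq : 0 < q)
    (hqu : q ≤ 4 ^ u) (hqb : q.Coprime b) (a : ℤ) :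
    ∃ S ⊆ range (b ^ 2 * (4 * (u + 1) + 4) * (2 * u + 2)), S.Nonempty ∧
      distNearestInt (∑ d ∈ S, (a : ℝ) / q * b ^ d) ≤ 1 / 2 ^ (u + 1) := by
  have hq' : (0 : ℝ) < q := by exact_mod_cast hq
  have hb' : (2 : ℝ) ≤ b := by exact_mod_cast hb
  refine exists_subset_sum_distNearestInt_le _ (u + 1) ?_ _ fun k _ _ ↦ ?_
  · have : 2 ≤ b ^ 2 := by nlinarith
    have : 2 ≤ b ^ 2 * (4 * (u + 1) + 4) := by nlinarith
    nlinarith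
  -- Either the mean is exactly 1, or, `b` being invertible mod `q`, the orbit stays at least `1/q ≥
  -- 4^(-u)` from integers and cannot remain below `1/(2b)` for `2u + 2` steps.
  by_cases hdvd : (q : ℤ) ∣ k * a
  · obtain ⟨c, hc⟩ := hdvd
    have h1 : subsetSumMean (b ^ 2 * (4 * (u + 1) + 4) * (2 * u + 2))
        (fun d ↦ (a : ℝ) / q * b ^ d) k = 1 := by
      refine prod_eq_one fun d _ ↦ ?_
      have h2 : (k : ℝ) * (a / q * b ^ d) = ((c * b ^ d : ℤ) : ℝ) := by
        have : (k : ℝ) * a = q * c := by exact_mod_cast hc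
        push_cast
        field_simp
        linear_combination this
      rw [h2, unitExp_intCast]
      norm_num
    rw [h1, Complex.one_re]
    have : 0 ≤ 1 / (4 * ((4 ^ (u + 1) : ℕ) : ℝ)) := by positivity
    linarith
  · have h1 := norm_subsetSumMean_le_of_windows hb (b ^ 2 * (4 * (u + 1) + 4) * (2 * u + 2))
      (u + 1) (2 * u + 2) (fun d ↦ (a : ℝ) / q * b ^ d) k le_rfl ?_
    · exact (neg_le_neg h1).trans (abs_le.1 (Complex.abs_re_le_norm _)).1
    · intro j _
      by_contra! hcon
      set d := j * (2 * u + 2)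
      have h2 := distNearestInt_pow_mul_le (by omega : 0 < b) ((k : ℝ) * (a / q)) d (2 * u + 2)
        fun i hi ↦ by
          rw [mul_assoc]
          exact hcon i hi
      have h3 : (k : ℝ) * (a / q) * b ^ d = ((k * a * b ^ d : ℤ) : ℝ) / q := by
        push_cast
        ring
      have h4 : ¬ (q : ℤ) ∣ k * a * b ^ d := by
        intro h
        have : IsCoprime (q : ℤ) ((b : ℤ) ^ d) := (Nat.isCoprime_iff_coprime.2 hqb).pow_right
        exact hdvd (this.dvd_of_dvd_mul_right h)
      have h5 := one_div_le_distNearestInt_div hq h4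
      rw [← h3] at h5
      have h6 : (q : ℝ) ≤ b ^ (2 * u + 2) := by
        calc (q : ℝ) ≤ (4 ^ u : ℕ) := by exact_mod_cast hqu
          _ = (2 : ℝ) ^ (2 * u) := by
            rw [pow_mul]
            norm_num
          _ ≤ 2 ^ (2 * u + 2) := pow_le_pow_right₀ (by norm_num) (by omega)
          _ ≤ b ^ (2 * u + 2) := pow_le_pow_left₀ (by norm_num) hb' _
      have h7 : 1 ≤ 1 / (q : ℝ) * b ^ (2 * u + 2) := by
        rw [one_div_mul_eq_div, le_div_iff₀ hq']
        linarith
      have h8 := mul_le_mul_of_nonneg_right h5 (by positivity : (0 : ℝ) ≤ b ^ (2 * u + 2))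
      linarith

theorem abs_sum_mul_pow_le {b : ℕ} (hb : 2 ≤ b) {K : ℕ} {S : Finset ℕ} (hS : S ⊆ range K)
    (c : ℝ) : |∑ d ∈ S, c * (b : ℝ) ^ d| ≤ |c| * b ^ K := by
  rw [← mul_sum, abs_mul]
  gcongr
  rw [abs_of_nonneg (by positivity)]
  exact_mod_cast (Nat.geomSum_lt hb fun k hk ↦ mem_range.1 (hS hk)).le

theorem exists_subset_sum_of_near_rational {b : ℕ} (hb : 2 ≤ b) (u q : ℕ) (hq : 0 < q)
    (hqu : q ≤ 4 ^ u) (hqb : q.Coprime b) (a : ℤ) (θ : ℝ)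
    (hθ : |θ - a / q| * b ^ (b ^ 2 * (4 * (u + 1) + 4) * (2 * u + 2)) ≤ 1 / 2 ^ (u + 1)) :
    ∃ S ⊆ range (b ^ 2 * (4 * (u + 1) + 4) * (2 * u + 2)), S.Nonempty ∧
      distNearestInt (∑ d ∈ S, θ * b ^ d) ≤ 1 / 2 ^ u := by
  obtain ⟨S, hS, hne, hd⟩ := exists_subset_sum_rational hb u q hq hqu hqb a
  refine ⟨S, hS, hne, (distNearestInt_le_add_abs_sub _ (∑ d ∈ S, (a : ℝ) / q * b ^ d)).trans ?_⟩
  have h1 := abs_sum_mul_pow_le hb hS (θ - a / q)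
  rw [← sum_sub_distrib]
  simp only [← sub_mul]
  have h2 : (1 : ℝ) / 2 ^ u = 1 / 2 ^ (u + 1) + 1 / 2 ^ (u + 1) := by
    rw [pow_succ]
    field_simp
    norm_num
  linarith

theorem near_rational_of_small_multiple {b : ℕ} (hb : 2 ≤ b) {u h : ℕ} (hh : 0 < h)
    (hu : h ≤ 4 ^ u) (θ : ℝ) {L : ℕ} (hθ : distNearestInt (h * θ) * b ^ L ≤ 1 / 2) :
    ∃ q e : ℕ, ∃ a : ℤ, 0 < q ∧ q ≤ 4 ^ u ∧ q.Coprime b ∧ e ≤ 2 * u ∧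
      |θ * b ^ e - a / q| * b ^ L ≤ b ^ e := by
  obtain ⟨q, e, hq, hqh, hqb, he, c, hc⟩ := exists_coprime_dvd_mul_pow (b := b) h hh
  refine ⟨q, e, c * round (h * θ), hq, hqh.trans hu, hqb, ?_, ?_⟩
  · have : 2 ^ e ≤ 2 ^ (2 * u) := by
      rw [pow_mul]
      exact he.trans hu
    exact (Nat.pow_le_pow_iff_right (by norm_num)).1 this
  · have hq' : (0 : ℝ) < q := by exact_mod_cast hq
    have hh' : (1 : ℝ) ≤ h := by exact_mod_cast hh
    have hc' : (q : ℝ) * b ^ e = h * c := by exact_mod_cast hc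
    have h1 : θ * b ^ e - ((c * round (h * θ) : ℤ) : ℝ) / q =
        (c : ℝ) / q * (h * θ - round (h * θ)) := by
      push_cast
      field_simp
      linear_combination θ * hc'
    have h2 : (c : ℝ) / q ≤ b ^ e := by
      rw [div_le_iff₀ hq']
      nlinarith [Nat.cast_nonneg (α := ℝ) c]
    rw [h1, abs_mul, abs_of_nonneg (by positivity : (0 : ℝ) ≤ (c : ℝ) / q), mul_assoc]
    unfold distNearestInt at hθ
    calc (c : ℝ) / q * (|h * θ - round (h * θ)| * b ^ L) ≤ b ^ e * 1 := by
          gcongr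
          linarith
      _ = b ^ e := mul_one _

/-- Among the first `O(b ^ 4 u ^ 3)` elements of an orbit of multiplication by `b` on `ℝ / ℤ`, some
nonempty subset has a sum within `2 ^ (-u)` of zero. -/
theorem exists_subset_sum_orbit {b : ℕ} (hb : 2 ≤ b) (u K : ℕ)
    (hK : 32 * b ^ 4 * (u + 2) ^ 3 ≤ K) (γ : ℝ) :
    ∃ S ⊆ range K, S.Nonempty ∧ distNearestInt (∑ d ∈ S, γ * b ^ d) ≤ 1 / 2 ^ u := by
  have hb' : (2 : ℝ) ≤ b := by exact_mod_cast hb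
  have hb4 : 4 ≤ b ^ 2 := by nlinarith
  set L' := b ^ 2 * (4 * (u + 1) + 4) * (2 * u + 2) with hL'
  -- `b^L'` covers the growth of the error over the rational's subset sum, `b^(2u)` the shift by
  -- `e`, and `b^(u+1)` the tolerance `2^(-(u+1))`.
  set L := L' + 3 * u + 1 with hL
  have hLle : L ≤ 8 * b ^ 2 * (u + 2) ^ 2 := by
    rw [hL, hL']
    nlinarith
  have hRL : b ^ 2 * (4 * u + 4) * L ≤ K := by
    refine le_trans ?_ hK
    calc b ^ 2 * (4 * u + 4) * L ≤ b ^ 2 * (4 * (u + 2)) * (8 * b ^ 2 * (u + 2) ^ 2) := by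
          gcongr
          omega
      _ = _ := by ring
  by_cases hall : ∀ k : ℤ, k ≠ 0 → |k| < (4 ^ u : ℕ) →
      -(1 / (4 * (4 ^ u : ℕ))) ≤ (subsetSumMean K (fun d ↦ γ * b ^ d) k).re
  · refine exists_subset_sum_distNearestInt_le K u ?_ _ hall
    refine le_trans ?_ hRL
    have : 2 ≤ b ^ 2 * (4 * u + 4) := by nlinarith
    have : u + 1 ≤ L := by omega
    nlinarith
  push Not at hall
  obtain ⟨k, hk0, hku, hk⟩ := hall
  have hnorm : 1 / (4 * ((4 ^ u : ℕ) : ℝ)) < ‖subsetSumMean K (fun d ↦ γ * b ^ d) k‖ := by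
    have := (abs_le.1 (Complex.abs_re_le_norm (subsetSumMean K (fun d ↦ γ * b ^ d) k))).1
    linarith
  obtain ⟨j, hj, hsmall⟩ : ∃ j < b ^ 2 * (4 * u + 4), ∀ i < L,
      distNearestInt (k * (γ * b ^ (j * L + i))) < 1 / (2 * b) := by
    by_contra! hcon
    exact absurd (norm_subsetSumMean_le_of_windows hb K u L _ k hRL hcon) (not_le.2 hnorm)
  have hend : j * L + L ≤ K := by nlinarith
  set d₀ := j * L
  have h1 := distNearestInt_pow_mul_le (by omega : 0 < b) ((k : ℝ) * γ) d₀ L fun i hi ↦ by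
    rw [mul_assoc]
    exact hsmall i hi
  have h2 : distNearestInt ((k.natAbs : ℝ) * (γ * b ^ d₀)) * b ^ L ≤ 1 / 2 := by
    rw [mul_assoc] at h1
    rw [Nat.cast_natAbs, Int.cast_abs]
    rcases abs_choice (k : ℝ) with hk | hk <;> rw [hk]
    · exact h1
    · rwa [neg_mul, distNearestInt_neg]
  have hkn : k.natAbs ≤ 4 ^ u := by
    rw [Int.abs_eq_natAbs] at hku
    exact (Int.ofNat_lt.1 hku).le
  obtain ⟨q, e, a, hq, hqu, hqb, he, ha⟩ := near_rational_of_small_multiple hb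
    (Int.natAbs_pos.2 hk0) hkn (γ * b ^ d₀) h2
  obtain ⟨S, hS, hne, hd⟩ := exists_subset_sum_of_near_rational hb u q hq hqu hqb a
    (γ * b ^ d₀ * b ^ e) (by
      rw [← hL']
      have h3 : (b : ℝ) ^ L = b ^ L' * b ^ (2 * u) * b ^ (u + 1) := by
        rw [← pow_add, ← pow_add]
        congr 1
        omega
      have h4 : (b : ℝ) ^ e ≤ b ^ (2 * u) := pow_le_pow_right₀ (by linarith) he
      have h5 : (2 : ℝ) ^ (u + 1) ≤ b ^ (u + 1) := pow_le_pow_left₀ (by norm_num) hb' _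
      rw [le_div_iff₀ (by positivity)]
      have h6 : (0 : ℝ) < b ^ (2 * u) := by positivity
      refine le_of_mul_le_mul_right ?_ h6
      rw [h3] at ha
      refine le_trans ?_ (ha.trans (h4.trans_eq (one_mul _).symm))
      calc _ ≤ |γ * b ^ d₀ * b ^ e - a / q| * b ^ L' * b ^ (u + 1) * b ^ (2 * u) := by gcongr
        _ = _ := by ring)
  refine ⟨S.image (d₀ + e + ·), ?_, hne.image _, ?_⟩
  · intro d hd
    rw [mem_image] at hd
    obtain ⟨i, hi, rfl⟩ := hd
    have := mem_range.1 (hS hi)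
    rw [mem_range]
    omega
  · rw [sum_image (fun _ _ _ _ h ↦ by simpa using h)]
    convert hd using 3
    rw [pow_add, pow_add]
    ring

/-! ### The main theorem -/

theorem add_three_pow_six_le (u : ℕ) : (u + 3) ^ 6 ≤ 2 ^ 14 * 2 ^ u := by
  -- From `u = 6` on, the left side grows by a factor below 2 per step.
  by_cases hu : u < 6
  · interval_cases u <;> norm_num
  · obtain ⟨v, rfl⟩ := Nat.exists_eq_add_of_le (not_lt.1 hu)
    induction v with
    | zero => norm_num
    | succ v ih =>
      have h1 := ih (by omega)
      have h2 : (6 + (v + 1) + 3) ^ 6 ≤ 2 * (6 + v + 3) ^ 6 := by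
        ring_nf
        gcongr ?_ + ?_ + ?_ + ?_ + ?_ + ?_ + ?_ <;> omega
      calc (6 + (v + 1) + 3) ^ 6 ≤ 2 * (2 ^ 14 * 2 ^ (6 + v)) := h2.trans (by omega)
        _ = _ := by ring

theorem log_le_of_natLog {b N : ℕ} (hb : 2 ≤ b) (hN : 2 ≤ N) :
    Real.log N ≤ ((Nat.log b N + 1 : ℕ) : ℝ) * b := by
  have h1 : N < b ^ (Nat.log b N + 1) := Nat.lt_pow_succ_log_self (by omega) N
  have h2 : (N : ℝ) ≤ (b : ℝ) ^ (Nat.log b N + 1) := by exact_mod_cast h1.le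
  have hN' : (0 : ℝ) < N := by exact_mod_cast (by omega : 0 < N)
  have h3 := Real.log_le_log hN' h2
  rw [Real.log_pow] at h3
  refine h3.trans ?_
  gcongr
  exact Real.log_le_self (by positivity)

theorem computable_constant : Computable fun b : ℕ ↦ 2 ^ 24 * b ^ 10 := by
  have hpow : ∀ k : ℕ, Primrec fun b : ℕ ↦ b ^ k := by
    intro k
    induction k with
    | zero => simpa using Primrec.const 1
    | succ k ih =>
      simp only [pow_succ]
      exact Primrec.nat_mul.comp ih Primrec.id
  exact (Primrec.nat_mul.comp (Primrec.const (2 ^ 24)) (hpow 10)).to_comp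

theorem exists_zeroOneDigit_distNearestInt_le {b : ℕ} (hb : 2 ≤ b) (u N : ℕ) (hN : N ≠ 0)
    (hu : 32 * b ^ 4 * (u + 2) ^ 3 ≤ Nat.log b N) (γ : ℝ) :
    ∃ n ∈ zeroOneDigitSet b, 1 ≤ n ∧ n ≤ N ∧ distNearestInt (γ * n) ≤ 1 / 2 ^ u := by
  obtain ⟨S, hS, hne, hd⟩ := exists_subset_sum_orbit hb u _ hu γ
  refine ⟨∑ d ∈ S, b ^ d, ⟨S, hne, rfl⟩, ?_, ?_, ?_⟩
  · exact sum_pos (fun d _ ↦ Nat.pow_pos (n := d) (by omega : 0 < b)) hne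
  · exact (Nat.geomSum_lt hb fun k hk ↦ mem_range.1 (hS hk)).le.trans (Nat.pow_log_le_self b hN)
  · push_cast
    rwa [mul_sum]

/-- Effectiveness of the constant is expressed by computability of the function `b ↦ C b`; every
real constant that is effectively bounded above may be replaced by a computable natural number. -/
theorem theorem1p1 :
    ∃ C : ℕ → ℕ, Computable C ∧
      ∀ b : ℕ, 2 ≤ b → ∀ γ : ℝ, ∀ N : ℕ, 2 ≤ N →
        ∃ n ∈ zeroOneDigitSet b, 1 ≤ n ∧ n ≤ N ∧
          distNearestInt (γ * n) ≤ (C b : ℝ) / (Real.log N) ^ 2 := by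
  -- Squaring `log N ≤ 32 b^5 (u+3)^3` gives `2^10 b^10 (u+3)^6`; `add_three_pow_six_le` supplies
  -- the other `2^14`.
  refine ⟨fun b ↦ 2 ^ 24 * b ^ 10, computable_constant, fun b hb γ N hN ↦ ?_⟩
  have hlogpos : 0 < Real.log N := Real.log_pos (by exact_mod_cast hN)
  have hlog := log_le_of_natLog hb hN
  set K := Nat.log b N with hKdef
  have hbound : ∀ m : ℕ, K + 1 ≤ 32 * b ^ 4 * m ^ 3 →
      Real.log N ^ 2 ≤ 2 ^ 10 * (b : ℝ) ^ 10 * (m : ℝ) ^ 6 := by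
    intro m hm
    have h1 : ((K + 1 : ℕ) : ℝ) ≤ 32 * b ^ 4 * m ^ 3 := by exact_mod_cast hm
    have h2 : Real.log N ≤ 32 * b ^ 4 * m ^ 3 * b := hlog.trans (by gcongr)
    calc Real.log N ^ 2 ≤ (32 * (b : ℝ) ^ 4 * m ^ 3 * b) ^ 2 :=
          pow_le_pow_left₀ hlogpos.le h2 2
      _ = _ := by ring
  -- For small `N` the choice `n = 1` and the trivial bound `1/2` suffice.
  by_cases hK : K < 32 * b ^ 4 * 2 ^ 3
  · refine ⟨1, ⟨{0}, by simp, by simp⟩, le_rfl, by omega, ?_⟩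
    rw [le_div_iff₀ (by positivity)]
    have h1 := hbound 2 hK
    have h2 := distNearestInt_le_half (γ * (1 : ℕ))
    have h3 : (0 : ℝ) ≤ (b : ℝ) ^ 10 := by positivity
    push_cast at *
    nlinarith [sq_nonneg (Real.log N)]
  · set P : ℕ → Prop := fun u ↦ 32 * b ^ 4 * (u + 2) ^ 3 ≤ K
    have hP0 : P 0 := not_lt.1 hK
    -- Failure at `u + 1` is what bounds `log N` above in terms of `u`.
    obtain ⟨u, hu, hu'⟩ : ∃ u, P u ∧ ¬ P (u + 1) := by
      by_contra! hcon
      have hall : ∀ u, P u := fun u ↦ Nat.rec hP0 hcon u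
      have h1 : 32 * b ^ 4 * (K + 2) ^ 3 ≤ K := hall K
      have h2 : 1 ≤ 32 * b ^ 4 := Nat.succ_le_of_lt (by positivity)
      have h3 : K + 2 ≤ (K + 2) ^ 3 := Nat.le_self_pow (by norm_num) _
      nlinarith
    obtain ⟨n, hn, hn1, hnN, hd⟩ :=
      exists_zeroOneDigit_distNearestInt_le hb u N (by omega) hu γ
    refine ⟨n, hn, hn1, hnN, hd.trans ?_⟩
    rw [div_le_div_iff₀ (by positivity) (by positivity), one_mul]
    have h1 := hbound (u + 3) (not_le.1 hu')
    have h2 : ((u + 3 : ℕ) : ℝ) ^ 6 ≤ 2 ^ 14 * 2 ^ u := by exact_mod_cast add_three_pow_six_le u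
    calc Real.log N ^ 2 ≤ 2 ^ 10 * (b : ℝ) ^ 10 * (2 ^ 14 * 2 ^ u) := h1.trans (by gcongr)
      _ = _ := by
        push_cast
        ring
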